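/- A tile type is a unit square carrying a glue (a label and a strength in $\mathbb{N}$) on each of its four sides. An assembly over a finite set $T$ of tile types is a partial function $\alpha : \mathbb{Z}^2 \dashrightarrow T$. Two tiles of $\alpha$ at adjacent positions interact if the glues on their abutting side are equal and have positive strength; the binding graph of $\alpha$ has vertex set $\operatorname{dom}\alpha$ and an edge, weighted by the glue strength, for each interacting pair, and $\alpha$ is $\tau$-stable if every cut of this graph has weight at least $\tau$. A tile assembly system is a triple $\mathcal{T}=(T,\sigma,\tau)$ with $T$ a finite set of tile types, $\sigma$ an assembly over $T$ (the seed) and $\tau\in\mathbb{N}$ (the temperature). For $\tau$-stable assemblies write $\alpha\to_1\beta$ if $\beta$ extends $\alpha$ by exactly one tile. The productions of $\mathcal{T}$ are the assemblies reachable from $\sigma$ by finitely many steps $\to_1$, and a production $\alpha$ is terminal if $\alpha\to_1\beta$ for no $\beta$. The Manhattan diameter of a set of points of $\mathbb{Z}^2$ is the largest Manhattan distance between two of its points. **Theorem.** There is a tile assembly system $\mathcal{T}=(T,\sigma,1)$ at temperature $1$ such that $|\operatorname{dom}\sigma|=1$, $|T|=4825$, there is no infinite sequence $\sigma=\alpha_0\to_1\alpha_1\to_1\alpha_2\to_1\cdots$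 (so terminal assemblies exist, and every production grows into one), and every terminal assembly $\alpha$ of $\mathcal{T}$ has the following properties: 1. the largest Manhattan distance from the seed tile to a tile of $\alpha$ is exactly $4845$, and the Manhattan diameter of $\alpha$ is also exactly $4845$; 2. the binding graph of $\alpha$ contains a (simple) path $P=(P_0,\dots,P_\ell)$ whose Manhattan diameter is strictly larger than $|T|+1$ and which is partially pumped: some part of $P$ consists of consecutive repetitions of one of its subpaths, i.e. there are integers $i\ge 0$, $k\ge 1$, $m\ge 2$ with $i+mk\le \ell$ and a vector $w\in\mathbb{Z}^2$ such that $P_{j+k}=P_j+w$ and $\alpha(P_{j+k})=\alpha(P_j)$ for all $j$ with $i\le j\le i+(m-1)k$. -/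

import Mathlib

/-- The four sides of a unit square tile. -/
inductive Dir where
  | north
  | east
  | south
  | west

/-- The opposite side. -/
def Dir.opp : Dir → Dir
  | .north => .south
  | .east => .west
  | .south => .north
  | .west => .east

/-- The unit vector of `ℤ × ℤ` pointing in a given direction. -/
def Dir.vec : Dir → ℤ × ℤ
  | .north => (0, 1)
  | .east => (1, 0)
  | .south => (0, -1)
  | .west => (-1, 0)

/-- A glue: a label together with a nonnegative integer strength. -/
structure Glue where
  label : ℕ
  strength : ℕ

/-- A tile type: a unit square with one glue on each of its four sides. -/
structure TileType where
  north : Glue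
  east : Glue
  south : Glue
  west : Glue

/-- The glue of a tile type on a given side. -/
def TileType.glue (t : TileType) : Dir → Glue
  | .north => t.north
  | .east => t.east
  | .south => t.south
  | .west => t.west

/-- An assembly over the tile set `T`: a partial function from `ℤ × ℤ` to `T`. -/
def Assembly (T : Finset TileType) : Type :=
  ℤ × ℤ → Option {t : TileType // t ∈ T}

namespace Assembly

variable {T : Finset TileType}

/-- The domain of an assembly: the set of occupied positions. -/
def dom (α : Assembly T) : Set (ℤ × ℤ) := {p | α p ≠ none}

/-- The tile at position `q` abuts the tile at position `p` on its side `d`, both positions being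
occupied, and the two tiles interact with strength `s`: the glues on the abutting side are equal
and have the positive strength `s`. -/
def Interact (α : Assembly T) (p q : ℤ × ℤ) (d : Dir) (s : ℕ) : Prop :=
  q = p + d.vec ∧ 0 < s ∧
    ∃ t u : {t : TileType // t ∈ T}, α p = some t ∧ α q = some u ∧
      t.1.glue d = u.1.glue d.opp ∧ (t.1.glue d).strength = s

theorem Interact.symm {α : Assembly T} {p q : ℤ × ℤ} {d : Dir} {s : ℕ}
    (h : α.Interact p q d s) : α.Interact q p d.opp s := by
  obtain ⟨rfl, hs, t, u, ht, hu, hg, hst⟩ := h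
  refine ⟨?_, hs, u, t, hu, ht, ?_, ?_⟩
  · cases d <;> ext <;> simp [Dir.opp, Dir.vec]
  · cases d <;> exact hg.symm
  · rw [← hg, hst]

/-- The binding graph of an assembly: its vertices are the occupied positions, its edges the pairs
of interacting tiles. -/
def bindingGraph (α : Assembly T) : SimpleGraph α.dom where
  Adj p q := ∃ d s, α.Interact p q d s
  symm := ⟨fun _ _ ⟨d, s, h⟩ => ⟨d.opp, s, h.symm⟩⟩
  loopless := ⟨by
    rintro ⟨p, _⟩ ⟨d, s, h, _⟩
    cases d <;> simp [Dir.vec, Prod.ext_iff] at h⟩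

open Classical in
/-- The weight of the pair `(p, q)` in the binding graph: the strength of the interaction between
the tiles at `p` and `q`, and `0` if they do not interact. -/
noncomputable def bindingWeight (α : Assembly T) (p q : ℤ × ℤ) : ℕ :=
  if h : ∃ s d, α.Interact p q d s then h.choose else 0

/-- An assembly is `τ`-stable if every cut of its binding graph (a partition of the domain into two
nonempty parts `S` and `dom α \ S`) has weight at least `τ`. Since weights are natural numbers, this
means that finitely many edges of the cut already have total weight at least `τ`. -/
def Stable (τ : ℕ) (α : Assembly T) : Prop :=
  ∀ S : Set (ℤ × ℤ), S ⊆ α.dom → S.Nonempty → (α.dom \ S).Nonempty →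
    ∃ F : Finset ((ℤ × ℤ) × (ℤ × ℤ)),
      (∀ e ∈ F, e.1 ∈ S ∧ e.2 ∈ α.dom \ S) ∧ τ ≤ ∑ e ∈ F, α.bindingWeight e.1 e.2

/-- `α` is a subassembly of `β`. -/
def Sub (α β : Assembly T) : Prop :=
  α.dom ⊆ β.dom ∧ ∀ p ∈ α.dom, α p = β p

/-- `β` is obtained from `α` by the binding of a single tile, at temperature `τ`. -/
def Step (τ : ℕ) (α β : Assembly T) : Prop :=
  α.Stable τ ∧ β.Stable τ ∧ α.Sub β ∧ (β.dom \ α.dom).ncard = 1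

end Assembly

/-- A tile assembly system `(T, σ, τ)`: a finite tile set, a seed and a temperature. -/
structure TileAssemblySystem where
  tiles : Finset TileType
  seed : Assembly tiles
  temperature : ℕ

namespace TileAssemblySystem

/-- The productions of a system: the assemblies obtained from the seed by finitely many
(possibly zero) bindings of a single tile. -/
def productions (𝒯 : TileAssemblySystem) : Set (Assembly 𝒯.tiles) :=
  {α | Relation.ReflTransGen (Assembly.Step 𝒯.temperature) 𝒯.seed α}

/-- The terminal assemblies of a system: the productions to which no tile can bind. -/
def terminalAssemblies (𝒯 : TileAssemblySystem) : Set (Assembly 𝒯.tiles) :=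
  {α | α ∈ 𝒯.productions ∧ ¬ ∃ β, Assembly.Step 𝒯.temperature α β}

end TileAssemblySystem

/-- The Manhattan distance between two points of `ℤ × ℤ`. -/
def manhattanDist (p q : ℤ × ℤ) : ℕ := (p.1 - q.1).natAbs + (p.2 - q.2).natAbs

/-- The Manhattan diameter of a set of positions (infinite if distances are unbounded). -/
noncomputable def manhattanDiam (S : Set (ℤ × ℤ)) : ℕ∞ :=
  ⨆ p ∈ S, ⨆ q ∈ S, (manhattanDist p q : ℕ∞)

/-- The Manhattan radius of a set of positions around the point `o`. -/
noncomputable def manhattanRadius (o : ℤ × ℤ) (S : Set (ℤ × ℤ)) : ℕ∞ :=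
  ⨆ p ∈ S, (manhattanDist o p : ℕ∞)

namespace Assembly

variable {T : Finset TileType}

/-- The set of positions visited by a walk in the binding graph. -/
def positions {α : Assembly T} {u v : α.dom} (P : α.bindingGraph.Walk u v) : Set (ℤ × ℤ) :=
  {p | ∃ x ∈ P.support, (x : ℤ × ℤ) = p}

/-- A walk `P` in the binding graph is partially pumped if some part `P_i, …, P_{i + m * k}` of it
consists of `m ≥ 2` consecutive repetitions of one subpath `P_i, …, P_{i + k}` with `k ≥ 1`: each
repetition starts where the previous one ends, carries the same tile types, and is the translate of
the previous one by a fixed vector `w`. -/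
def PartiallyPumped {α : Assembly T} {u v : α.dom} (P : α.bindingGraph.Walk u v) : Prop :=
  ∃ (i k m : ℕ) (w : ℤ × ℤ), 1 ≤ k ∧ 2 ≤ m ∧ i + m * k ≤ P.length ∧
    ∀ j, i ≤ j → j + k ≤ i + m * k →
      (P.getVert (j + k) : ℤ × ℤ) = (P.getVert j : ℤ × ℤ) + w ∧
        α (P.getVert (j + k)) = α (P.getVert j)

end Assembly

/-! Every non-seed kind is entered from one fixed direction, so at temperature 1 a bond always joins
a tile to a successor that it offers (`KindSystem.out_of_glue_eq`). Growth could still depend on the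
order of attachment, when two branches compete for a position. This is excluded by displaying a
finite tree of placed tiles in which every offer is either a child in the tree or lies at a position
held by an ancestor of the offering tile (`GrowthTree.complete`). A production is then always a
subtree containing the root (`Covers.step`), because the ancestors of a present tile are present and
the blocked positions are already full. A proper subtree can always grow (`Covers.exists_step`), so
the whole tree is the domain of every terminal assembly.

The concrete tree beats its number of tile types by reusing strands. On the way to the summit,
strands `6` and `7` are each climbed three times; between climbs strand `14` descends beside strand
`7`, and the next copies of `6` and `7` end almost a strand length higher. Blocking by ancestors
selects a different exit each time, so the reuse stops. This brings the summit to distance 4845 with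
4825 types. A separate hook at the seed holds three equal tiles in a row; the path from their tip to
the summit is both pumped and long enough.

Order independence, disjointness and extent all reduce to finite checks on 94 straight arms, done by
kernel evaluation. -/

instance Dir.instDecidableEq : DecidableEq Dir := fun a b => by
  cases a <;> cases b <;> first | exact isTrue rfl | exact isFalse (by intro h; cases h)

theorem Dir.opp_ne (d : Dir) : d.opp ≠ d := by cases d <;> simp [Dir.opp]

theorem Dir.vec_opp (d : Dir) : d.opp.vec = -d.vec := by cases d <;> rfl

/-! ### Tile kinds with a single entry side, and their glues -/

/-- A set of tile kinds in which every kind is entered from a single direction. A kind offers at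
most one successor in each direction, and nothing may grow back into the seed kind. -/
structure KindSystem (τ : Type) where
  label : τ → ℕ
  label_injective : Function.Injective label
  dir : τ → Dir
  seedKind : τ
  out : τ → Dir → Option τ
  dir_of_out : ∀ {t d u}, out t d = some u → dir u = d
  out_opp : ∀ {t}, t ≠ seedKind → out t (dir t).opp = none
  out_ne_seed : ∀ {t d u}, out t d = some u → u ≠ seedKind

namespace KindSystem

variable {τ : Type} (K : KindSystem τ)

open Classical in
/-- The glue of a kind: its own label on the side through which it is entered, the label of the
successor on the sides where there is one, and strength zero elsewhere. -/
noncomputable def glue (t : τ) (d : Dir) : Glue :=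
  if t ≠ K.seedKind ∧ d = (K.dir t).opp then ⟨K.label t, 1⟩
  else match K.out t d with
    | some u => ⟨K.label u, 1⟩
    | none => ⟨0, 0⟩

/-- The tile type of a kind. -/
noncomputable def tile (t : τ) : TileType :=
  ⟨K.glue t .north, K.glue t .east, K.glue t .south, K.glue t .west⟩

theorem tile_glue (t : τ) (d : Dir) : (K.tile t).glue d = K.glue t d := by
  cases d <;> rfl

theorem glue_entry {t : τ} (ht : t ≠ K.seedKind) : K.glue t (K.dir t).opp = ⟨K.label t, 1⟩ := by
  simp [glue, ht]

theorem glue_of_out {t u : τ} {d : Dir} (h : K.out t d = some u) :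
    K.glue t d = ⟨K.label u, 1⟩ := by
  have hn : ¬ (t ≠ K.seedKind ∧ d = (K.dir t).opp) := by
    rintro ⟨ht, rfl⟩
    rw [K.out_opp ht] at h
    cases h
  rw [glue, if_neg hn, h]

theorem glue_cases {t : τ} {d : Dir} (h : 0 < (K.glue t d).strength) :
    (t ≠ K.seedKind ∧ d = (K.dir t).opp ∧ K.glue t d = ⟨K.label t, 1⟩) ∨
      ∃ u, K.out t d = some u ∧ K.glue t d = ⟨K.label u, 1⟩ := by
  by_cases hc : t ≠ K.seedKind ∧ d = (K.dir t).opp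
  · left
    exact ⟨hc.1, hc.2, by rw [hc.2, K.glue_entry hc.1]⟩
  · right
    cases ho : K.out t d with
    | none => simp [glue, hc, ho] at h
    | some u => exact ⟨u, rfl, K.glue_of_out ho⟩

/-- Two abutting tiles interact only if one of them is the successor of the other. -/
theorem out_of_glue_eq {a b : τ} {d : Dir} (hg : K.glue a d = K.glue b d.opp)
    (hs : 0 < (K.glue a d).strength) :
    K.out a d = some b ∨ (a ≠ K.seedKind ∧ d = (K.dir a).opp) := by
  rcases K.glue_cases hs with ⟨h1, h2, -⟩ | ⟨u, hu, hgu⟩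
  · exact Or.inr ⟨h1, h2⟩
  · left
    rw [hg] at hs
    rcases K.glue_cases hs with ⟨-, h2, h3⟩ | ⟨v, hv, hgv⟩
    · rw [← hg, hgu] at h3
      rw [hu, K.label_injective (Glue.mk.inj h3).1]
    · rw [← hg, hgu] at hgv
      have huv := K.label_injective (Glue.mk.inj hgv).1
      subst huv
      exact absurd ((K.dir_of_out hv).symm.trans (K.dir_of_out hu)) d.opp_ne

/-- The label on the entry side of `a` identifies it: `b` could show that label there as an offer
only if `a` were entered in the opposite direction. -/
theorem eq_of_tile_eq {a b : τ} (ha : a ≠ K.seedKind) (h : K.tile a = K.tile b) : a = b := by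
  have hg : K.glue a (K.dir a).opp = K.glue b (K.dir a).opp := by
    rw [← K.tile_glue, ← K.tile_glue, h]
  rw [K.glue_entry ha] at hg
  have hs : 0 < (K.glue b (K.dir a).opp).strength := by rw [← hg]; exact Nat.one_pos
  rcases K.glue_cases hs with ⟨-, -, h3⟩ | ⟨u, hu, hgu⟩
  · rw [← hg] at h3
    exact K.label_injective (Glue.mk.inj h3).1
  · rw [← hg] at hgu
    have hau := K.label_injective (Glue.mk.inj hgu).1
    subst hau
    exact absurd (K.dir_of_out hu).symm (K.dir a).opp_ne

theorem tile_injective : Function.Injective K.tile := by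
  intro a b h
  by_cases ha : a = K.seedKind
  · by_cases hb : b = K.seedKind
    · rw [ha, hb]
    · exact (K.eq_of_tile_eq hb h.symm).symm
  · exact K.eq_of_tile_eq ha h

/-- The tile set of a system of kinds. -/
noncomputable def tiles [Fintype τ] : Finset TileType :=
  Finset.univ.map ⟨K.tile, K.tile_injective⟩

theorem tiles_card [Fintype τ] : K.tiles.card = Fintype.card τ := by
  rw [tiles, Finset.card_map, Finset.card_univ]

theorem tile_mem [Fintype τ] (t : τ) : K.tile t ∈ K.tiles :=
  Finset.mem_map_of_mem ⟨K.tile, K.tile_injective⟩ (Finset.mem_univ t)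

theorem exists_of_mem_tiles [Fintype τ] (t : {t : TileType // t ∈ K.tiles}) :
    ∃ u, t = ⟨K.tile u, K.tile_mem u⟩ := by
  obtain ⟨t, ht⟩ := t
  obtain ⟨u, -, rfl⟩ := Finset.mem_map.1 ht
  exact ⟨u, rfl⟩

end KindSystem

/-! ### Growth trees: productions are subtrees -/

/-- A finite tree of placed tiles such that everything a tile of the tree offers to grow is either
in the tree or blocked by one of the ancestors of that tile. -/
structure GrowthTree {τ : Type} (K : KindSystem τ) (ι : Type) where
  pos : ι → ℤ × ℤ
  pos_injective : Function.Injective pos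
  kind : ι → τ
  root : ι
  parent : ι → ι
  kind_root : kind root = K.seedKind
  parent_root : parent root = root
  out_parent : ∀ {v}, v ≠ root → K.out (kind (parent v)) (K.dir (kind v)) = some (kind v)
  pos_eq : ∀ {v}, v ≠ root → pos v = pos (parent v) + (K.dir (kind v)).vec
  exists_iterate : ∀ v, ∃ k, parent^[k] v = root
  complete : ∀ {v d u}, K.out (kind v) d = some u →
    (∃ w, w ≠ root ∧ parent w = v ∧ kind w = u) ∨ ∃ k, pos (parent^[k] v) = pos v + d.vec

namespace Assembly

variable {T : Finset TileType}

theorem bindingWeight_pos_iff {α : Assembly T} {p q : ℤ × ℤ} :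
    0 < α.bindingWeight p q ↔ ∃ s d, α.Interact p q d s := by
  unfold bindingWeight
  split_ifs with h
  · obtain ⟨d, hd⟩ := h.choose_spec
    exact ⟨fun _ => h, fun _ => hd.2.1⟩
  · simp [h]

/-- In a stable assembly every tile that is not alone interacts with another one. -/
theorem Stable.exists_interact {α : Assembly T} (h : α.Stable 1) {z o : ℤ × ℤ} (hz : z ∈ α.dom)
    (ho : o ∈ α.dom) (hne : o ≠ z) : ∃ p ∈ α.dom, p ≠ z ∧ ∃ d s, α.Interact p z d s := by
  -- The cut that isolates `z` has positive weight.
  obtain ⟨F, hF, hsum⟩ := h {z} (by simpa using hz) (Set.singleton_nonempty z) ⟨o, ho, by simpa⟩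
  obtain ⟨e, he, hpos⟩ : ∃ e ∈ F, 0 < α.bindingWeight e.1 e.2 := by
    by_contra! hcon
    have : ∑ e ∈ F, α.bindingWeight e.1 e.2 = 0 :=
      Finset.sum_eq_zero fun e he => Nat.le_zero.1 (hcon e he)
    omega
  obtain ⟨h1, h2⟩ := hF e he
  obtain ⟨s, d, hi⟩ := bindingWeight_pos_iff.1 hpos
  rw [Set.mem_singleton_iff] at h1
  rw [h1] at hi
  exact ⟨e.2, h2.1, fun h => h2.2 (by simp [h]), d.opp, s, hi.symm⟩

end Assembly

namespace GrowthTree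

variable {τ ι : Type} {K : KindSystem τ} {G : GrowthTree K ι}

theorem kind_ne_seed {v : ι} (hv : v ≠ G.root) : G.kind v ≠ K.seedKind :=
  K.out_ne_seed (G.out_parent hv)

/-- If a set of positions separates a node from the root, it separates one of the ancestors of the
node from its parent. -/
theorem exists_crossing (S : Set (ℤ × ℤ)) {v : ι} (hv : G.pos v ∈ S) (hr : G.pos G.root ∉ S) :
    ∃ k, G.pos (G.parent^[k] v) ∈ S ∧ G.pos (G.parent^[k + 1] v) ∉ S := by
  by_contra! hcon
  obtain ⟨k, hk⟩ := G.exists_iterate v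
  have : ∀ k, G.pos (G.parent^[k] v) ∈ S := by
    intro k
    induction k with
    | zero => exact hv
    | succ k ih => exact hcon k ih
  exact hr (hk ▸ this k)

/-- A leaf whose parent has no other child is an ancestor of no other node, and its parent is an
ancestor of those two nodes only. -/
theorem iterate_parent_ne {a : ι} (ha : ∀ v, G.parent v ≠ a)
    (ha' : ∀ v, G.parent v = G.parent a → v = a) {v : ι} (hv : v ≠ a) (hv' : v ≠ G.parent a)
    (k : ℕ) : G.parent^[k] v ≠ a ∧ G.parent^[k] v ≠ G.parent a := by
  induction k with
  | zero => exact ⟨hv, hv'⟩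
  | succ k ih =>
    rw [Function.iterate_succ_apply']
    exact ⟨ha _, fun he => ih.1 (ha' _ he)⟩

variable [Fintype τ] (G)

/-- The assembly `α` is a subtree of `G` that contains the root. -/
structure Covers (α : Assembly K.tiles) : Prop where
  exists_node : ∀ p ∈ α.dom, ∃ v, G.pos v = p ∧ α p = some ⟨K.tile (G.kind v), K.tile_mem _⟩
  root_mem : G.pos G.root ∈ α.dom
  parent_mem : ∀ v, G.pos v ∈ α.dom → G.pos (G.parent v) ∈ α.dom

variable {G} {α β : Assembly K.tiles}

theorem Covers.apply (h : G.Covers α) {v : ι} (hv : G.pos v ∈ α.dom) :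
    α (G.pos v) = some ⟨K.tile (G.kind v), K.tile_mem _⟩ := by
  obtain ⟨w, hw, ha⟩ := h.exists_node _ hv
  rw [ha, G.pos_injective hw]

theorem Covers.iterate_mem (h : G.Covers α) {v : ι} (hv : G.pos v ∈ α.dom) (k : ℕ) :
    G.pos (G.parent^[k] v) ∈ α.dom := by
  induction k with
  | zero => exact hv
  | succ k ih =>
    rw [Function.iterate_succ_apply']
    exact h.parent_mem _ ih

theorem Covers.interact (h : G.Covers α) {v : ι} (hv : G.pos v ∈ α.dom) (hr : v ≠ G.root) :
    α.Interact (G.pos (G.parent v)) (G.pos v) (K.dir (G.kind v)) 1 := by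
  refine ⟨G.pos_eq hr, Nat.one_pos, _, _, h.apply (h.parent_mem v hv), h.apply hv, ?_, ?_⟩
  · rw [K.tile_glue, K.tile_glue, K.glue_of_out (G.out_parent hr), K.glue_entry (kind_ne_seed hr)]
  · rw [K.tile_glue, K.glue_of_out (G.out_parent hr)]

/-- A cut separates the root from some node, hence cuts a tree edge on the way between them, and
that edge has strength 1. -/
theorem Covers.stable (h : G.Covers α) : α.Stable 1 := by
  intro S hS hne hne'
  by_cases hr : G.pos G.root ∈ S
  · obtain ⟨p, hp, hpS⟩ := hne'
    obtain ⟨v, rfl, -⟩ := h.exists_node p hp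
    obtain ⟨k, hk, hk'⟩ := exists_crossing Sᶜ hpS (by simpa using hr)
    have hvr : G.parent^[k] v ≠ G.root := by
      intro he
      rw [he] at hk
      exact hk hr
    have hm := h.iterate_mem hp k
    refine ⟨{(G.pos (G.parent^[k + 1] v), G.pos (G.parent^[k] v))}, ?_, ?_⟩
    · simp only [Finset.mem_singleton, forall_eq]
      exact ⟨by simpa using hk', hm, hk⟩
    · rw [Finset.sum_singleton, Function.iterate_succ_apply']
      exact Assembly.bindingWeight_pos_iff.2 ⟨_, _, h.interact hm hvr⟩
  · obtain ⟨p, hp⟩ := hne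
    obtain ⟨v, rfl, -⟩ := h.exists_node p (hS hp)
    obtain ⟨k, hk, hk'⟩ := exists_crossing S hp hr
    have hvr : G.parent^[k] v ≠ G.root := by
      intro he
      rw [he] at hk
      exact hr hk
    have hm := h.iterate_mem (hS hp)
    refine ⟨{(G.pos (G.parent^[k] v), G.pos (G.parent^[k + 1] v))}, ?_, ?_⟩
    · simp only [Finset.mem_singleton, forall_eq]
      exact ⟨hk, hm (k + 1), hk'⟩
    · rw [Finset.sum_singleton, Function.iterate_succ_apply']
      exact Assembly.bindingWeight_pos_iff.2 ⟨_, _, (h.interact (hm k) hvr).symm⟩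

/-- This is the invariant behind order independence. The new tile bonds to a present node, which
either offers it or meets it on its own entry side. In the latter case the position is the parent's;
for an offer that is no child, it is an ancestor's. Both are already occupied, so only a child can
be added. -/
theorem Covers.step (h : G.Covers α) (hs : Assembly.Step 1 α β) : G.Covers β := by
  obtain ⟨-, hβ, ⟨hsub, heq⟩, hcard⟩ := hs
  obtain ⟨z, hz⟩ := Set.ncard_eq_one.1 hcard
  have hzm : z ∈ β.dom \ α.dom := by rw [hz]; rfl
  have hmem : ∀ p ∈ β.dom, p ≠ z → p ∈ α.dom := by
    intro p hp hpz
    by_contra hpα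
    have : p ∈ β.dom \ α.dom := ⟨hp, hpα⟩
    rw [hz] at this
    exact hpz this
  have hroot : G.pos G.root ≠ z := fun he => hzm.2 (he ▸ h.root_mem)
  obtain ⟨p, hp, hpz, d, s, rfl, hspos, t, u, ht, hu, hg, hst⟩ :=
    hβ.exists_interact hzm.1 (hsub h.root_mem) hroot
  have hpα := hmem p hp hpz
  obtain ⟨v, rfl, hv⟩ := h.exists_node p hpα
  rw [← heq _ hpα, hv] at ht
  cases ht
  obtain ⟨b, rfl⟩ := K.exists_of_mem_tiles u
  simp only [K.tile_glue] at hg hst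
  have hsucc : ∃ w, G.parent w = v ∧ G.pos w = G.pos v + d.vec ∧ G.kind w = b := by
    rcases K.out_of_glue_eq hg (by omega) with ho | ⟨hseed, hd⟩
    · rcases G.complete ho with ⟨w, hw, hwv, hwb⟩ | ⟨k, hk⟩
      · refine ⟨w, hwv, ?_, hwb⟩
        rw [G.pos_eq hw, hwv, hwb, K.dir_of_out ho]
      · exact absurd (hk ▸ h.iterate_mem hpα k) hzm.2
    · have hvr : v ≠ G.root := by
        rintro rfl
        exact hseed G.kind_root
      have : G.pos v + d.vec = G.pos (G.parent v) := by
        rw [hd, Dir.vec_opp, G.pos_eq hvr]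
        abel
      exact absurd (this ▸ h.parent_mem v hpα) hzm.2
  obtain ⟨w, hwv, hwz, rfl⟩ := hsucc
  refine ⟨fun p hp => ?_, hsub h.root_mem, fun x hx => ?_⟩
  · by_cases hpz : p = G.pos v + d.vec
    · exact ⟨w, hwz.trans hpz.symm, hpz ▸ hu⟩
    · obtain ⟨x, hx, hxp⟩ := h.exists_node p (hmem p hp hpz)
      exact ⟨x, hx, (heq p (hmem p hp hpz)) ▸ hxp⟩
  · by_cases hxz : G.pos x = G.pos v + d.vec
    · rw [G.pos_injective (hxz.trans hwz.symm), hwv]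
      exact hp
    · exact hsub (h.parent_mem x (hmem _ hx hxz))

/-- A proper subtree can grow. -/
theorem Covers.exists_step (h : G.Covers α) {v : ι} (hv : G.pos v ∉ α.dom) :
    ∃ β, Assembly.Step 1 α β := by
  -- Between a missing node and the root there is a missing node whose parent is present; it can
  -- attach.
  obtain ⟨k, hk, hk'⟩ := exists_crossing α.domᶜ hv (by simpa using h.root_mem)
  rw [Function.iterate_succ_apply'] at hk'
  set w := G.parent^[k] v
  rw [Set.mem_compl_iff, not_not] at hk'
  let β : Assembly K.tiles :=
    Function.update α (G.pos w) (some ⟨K.tile (G.kind w), K.tile_mem _⟩)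
  have hself : β (G.pos w) = some ⟨K.tile (G.kind w), K.tile_mem _⟩ := Function.update_self ..
  have hother : ∀ p, p ≠ G.pos w → β p = α p := fun p hp => Function.update_of_ne hp ..
  have hdom : β.dom = insert (G.pos w) α.dom := by
    ext p
    by_cases hp : p = G.pos w
    · subst hp
      simp [Assembly.dom, hself]
    · simp [Assembly.dom, hother p hp, hp]
  have hne : ∀ p ∈ α.dom, p ≠ G.pos w := fun p hp he => hk (he ▸ hp)
  have hβ : G.Covers β := by
    refine ⟨fun p hp => ?_, hdom ▸ Or.inr h.root_mem, fun x hx => ?_⟩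
    · rw [hdom] at hp
      rcases hp with rfl | hp
      · exact ⟨w, rfl, hself⟩
      · rw [hother p (hne p hp)]
        exact h.exists_node p hp
    · rw [hdom] at hx ⊢
      rcases hx with hx | hx
      · rw [G.pos_injective hx]
        exact Or.inr hk'
      · exact Or.inr (h.parent_mem x hx)
  refine ⟨β, h.stable, hβ.stable, ⟨hdom ▸ Set.subset_insert _ _, fun p hp => ?_⟩, ?_⟩
  · exact (hother p (hne p hp)).symm
  · rw [hdom, Set.insert_sdiff_of_notMem _ hk, Set.sdiff_self, ← Set.singleton_union,
      Set.union_empty, Set.ncard_singleton]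

/-! ### The system of a growth tree and its terminal assemblies -/

variable (G)

open Classical in
/-- The assembly that consists of the root only. -/
noncomputable def seed : Assembly K.tiles :=
  fun p => if p = G.pos G.root then some ⟨K.tile K.seedKind, K.tile_mem _⟩ else none

/-- The tile assembly system whose only terminal assembly is the whole tree. -/
noncomputable def system : TileAssemblySystem where
  tiles := K.tiles
  seed := G.seed
  temperature := 1

theorem dom_seed : G.seed.dom = {G.pos G.root} := by
  ext p
  simp [seed, Assembly.dom]

theorem covers_seed : G.Covers G.seed := by
  refine ⟨fun p hp => ?_, by rw [G.dom_seed]; rfl, fun v hv => ?_⟩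
  · rw [G.dom_seed] at hp
    exact ⟨G.root, hp.symm, by rw [G.kind_root]; exact if_pos hp⟩
  · rw [G.dom_seed] at hv ⊢
    rw [G.pos_injective hv, G.parent_root]
    rfl

variable {G}

theorem covers_of_mem_productions (h : α ∈ G.system.productions) : G.Covers α := by
  induction h with
  | refl => exact G.covers_seed
  | tail _ hs ih => exact ih.step hs

/-- In a terminal assembly the whole tree has grown. -/
theorem pos_mem_of_terminal (h : α ∈ G.system.terminalAssemblies) (v : ι) : G.pos v ∈ α.dom := by
  by_contra hv
  exact h.2 ((covers_of_mem_productions h.1).exists_step hv)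

theorem dom_of_terminal (h : α ∈ G.system.terminalAssemblies) : α.dom = Set.range G.pos := by
  ext p
  constructor
  · intro hp
    obtain ⟨v, hv, -⟩ := (covers_of_mem_productions h.1).exists_node p hp
    exact ⟨v, hv⟩
  · rintro ⟨v, rfl⟩
    exact pos_mem_of_terminal h v

/-- Each step adds one position, and all positions stay in the finite range of `G.pos`. -/
theorem not_exists_infinite [Finite ι] : ¬ ∃ a : ℕ → Assembly G.system.tiles,
    a 0 = G.system.seed ∧ ∀ i, Assembly.Step G.system.temperature (a i) (a (i + 1)) := by
  rintro ⟨a, h0, hs⟩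
  have hc : ∀ i, G.Covers (a i) := by
    intro i
    induction i with
    | zero => exact h0 ▸ G.covers_seed
    | succ i ih => exact ih.step (hs i)
  have hsub : ∀ i, (a i).dom ⊆ Set.range G.pos := by
    intro i p hp
    obtain ⟨v, hv, -⟩ := (hc i).exists_node p hp
    exact ⟨v, hv⟩
  have hfin := Set.finite_range G.pos
  have hle : ∀ i, i ≤ (a i).dom.ncard := by
    intro i
    induction i with
    | zero => exact Nat.zero_le _
    | succ i ih =>
      have := Set.ncard_sdiff_add_ncard_of_subset (hs i).2.2.1.1 (hfin.subset (hsub (i + 1)))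
      have h1 := (hs i).2.2.2
      omega
  have h1 := hle ((Set.range G.pos).ncard + 1)
  have h2 := Set.ncard_le_ncard (hsub ((Set.range G.pos).ncard + 1)) hfin
  omega

/-! ### Partially pumped paths in the binding graph -/

/-- The vertex of the binding graph at a node. -/
def vertex (h : ∀ v, G.pos v ∈ α.dom) (v : ι) : α.dom := ⟨G.pos v, h v⟩

theorem Covers.adj (hc : G.Covers α) (h : ∀ v, G.pos v ∈ α.dom) {v : ι} (hv : v ≠ G.root) :
    α.bindingGraph.Adj (vertex h v) (vertex h (G.parent v)) :=
  ⟨_, _, (hc.interact (h v) hv).symm⟩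

theorem Covers.exists_walk_root (hc : G.Covers α) (h : ∀ v, G.pos v ∈ α.dom) (v : ι) :
    ∃ W : α.bindingGraph.Walk (vertex h v) (vertex h G.root),
      ∀ x ∈ W.support, ∃ k, x = vertex h (G.parent^[k] v) := by
  obtain ⟨n, hn⟩ := G.exists_iterate v
  induction n generalizing v with
  | zero =>
    cases hn
    exact ⟨.nil, fun x hx => ⟨0, by simpa using hx⟩⟩
  | succ n ih =>
    by_cases hv : v = G.root
    · subst hv
      exact ⟨.nil, fun x hx => ⟨0, by simpa using hx⟩⟩
    obtain ⟨W, hW⟩ := ih (G.parent v) hn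
    refine ⟨.cons (hc.adj h hv) W, fun x hx => ?_⟩
    rw [SimpleGraph.Walk.support_cons, List.mem_cons] at hx
    rcases hx with rfl | hx
    · exact ⟨0, rfl⟩
    · obtain ⟨k, hk⟩ := hW x hx
      exact ⟨k + 1, hk⟩

/-- If the two tiles at the end of a branch repeat the one before them, then some partially pumped
path joins the end of that branch to any given node. -/
theorem exists_pumped_path (hc : G.Covers α) (h : ∀ v, G.pos v ∈ α.dom) {a b : ι}
    (ha : ∀ v, G.parent v ≠ a) (ha' : ∀ v, G.parent v = G.parent a → v = a)
    (hr : G.parent a ≠ G.root) (hba : b ≠ a) (hba' : b ≠ G.parent a)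
    (hk : G.kind (G.parent a) = G.kind a)
    (hk' : G.kind (G.parent (G.parent a)) = G.kind a) :
    ∃ P : α.bindingGraph.Walk (vertex h a) (vertex h b), P.IsPath ∧ Assembly.PartiallyPumped P := by
  have har : a ≠ G.root := fun he => ha G.root (by rw [G.parent_root, he])
  have h1 : G.parent a ≠ a := ha a
  have h2 : G.parent (G.parent a) ≠ G.parent a := fun he => h1 (ha' _ he)
  have hvertex : ∀ {v w}, vertex h v = vertex h w → v = w := fun he =>
    G.pos_injective (congrArg Subtype.val he)
  obtain ⟨W, hW⟩ := hc.exists_walk_root h (G.parent (G.parent a))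
  obtain ⟨W', hW'⟩ := hc.exists_walk_root h b
  classical
  -- The two walks to the root may share a segment; bypassing yields a path and only shrinks the
  -- support, so the last two tiles of the branch remain avoided.
  let Q := (W.append W'.reverse).bypass
  have hQ : Q.IsPath := SimpleGraph.Walk.bypass_isPath _
  have hsupp : ∀ x ∈ Q.support, x ≠ vertex h a ∧ x ≠ vertex h (G.parent a) := by
    intro x hx
    have hx' := SimpleGraph.Walk.support_bypass_subset_support _ hx
    rw [SimpleGraph.Walk.mem_support_append_iff, SimpleGraph.Walk.support_reverse,
      List.mem_reverse] at hx'
    rcases hx' with hx' | hx'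
    · obtain ⟨k, rfl⟩ := hW x hx'
      have := iterate_parent_ne ha ha' (ha _) h2 k
      exact ⟨fun he => this.1 (hvertex he), fun he => this.2 (hvertex he)⟩
    · obtain ⟨k, rfl⟩ := hW' x hx'
      have := iterate_parent_ne ha ha' hba hba' k
      exact ⟨fun he => this.1 (hvertex he), fun he => this.2 (hvertex he)⟩
  refine ⟨.cons (hc.adj h har) (.cons (hc.adj h hr) Q), ?_, ?_⟩
  · rw [SimpleGraph.Walk.cons_isPath_iff, SimpleGraph.Walk.cons_isPath_iff,
      SimpleGraph.Walk.support_cons, List.mem_cons]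
    refine ⟨⟨hQ, fun hm => (hsupp _ hm).2 rfl⟩, ?_⟩
    rintro (he | hm)
    · exact h1 (hvertex he).symm
    · exact (hsupp _ hm).1 rfl
  -- Three equal tiles give two repetitions of period 1. The vector is reversed because the path
  -- runs from the tip back towards the root.
  · refine ⟨0, 1, 2, -(K.dir (G.kind a)).vec, le_rfl, le_rfl, ?_, ?_⟩
    · simp only [SimpleGraph.Walk.length_cons]
      omega
    · intro j _ hj
      have hp := G.pos_eq har
      have hp' := G.pos_eq hr
      rw [hk] at hp'
      obtain rfl | rfl : j = 0 ∨ j = 1 := by omega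
      · simp only [SimpleGraph.Walk.getVert_cons_succ, SimpleGraph.Walk.getVert_zero]
        change G.pos (G.parent a) = G.pos a + _ ∧ α (G.pos (G.parent a)) = α (G.pos a)
        rw [hc.apply (h _), hc.apply (h _)]
        simp only [hk]
        exact ⟨by rw [hp]; abel, trivial⟩
      · simp only [SimpleGraph.Walk.getVert_cons_succ, SimpleGraph.Walk.getVert_zero]
        change G.pos (G.parent (G.parent a)) = G.pos (G.parent a) + _ ∧
          α (G.pos (G.parent (G.parent a))) = α (G.pos (G.parent a))
        rw [hc.apply (h _), hc.apply (h _)]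
        simp only [hk, hk']
        exact ⟨by rw [hp']; abel, trivial⟩

end GrowthTree

/-! ### The concrete tile set -/

/-- A straight sequence of consecutive tile kinds, all entered in the same direction. The last kind
is followed by the first kinds of the strands `next`. -/
structure Strand where
  dir : Dir
  len : ℕ
  next : List (Fin 29)

/-- The strands of the tile set.

The seed (strand `0`) is followed by strand `6` and by a hook (strands `1` to `4`), inside which the
single tile of strand `5` repeats itself until it hits the hook.

Three strands are used repeatedly. Strand `6` goes up to a junction with three exits. The middle
exit (strands `17` to `20`, very tall), the eastern one (`21` to `23`) and the western one (`24` to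
`28`) all lead to strand `7`. Strand `7` goes up to a junction with links to the east (`8` to `10`)
and to the west (`11` to `13`), both of which lead to strand `14`. Strand `14` comes down next to
strand `7` and may turn to strand `6` on either side.

After the middle exit only the eastern copy of strand `14` can turn, after the eastern exit only the
western copy, and after the western exit none: the turns are blocked by the end of the exit. The
strand `6` grown from the eastern copy ends below a link that leaves only the eastern exit free, and
the one grown from the western copy ends below a link that leaves only the western exit free. So
strand `7` is used three times on the way to the top, after which nothing can grow. -/
def strandList : List Strand := [
  ⟨.north, 1, [6, 1]⟩,
  ⟨.east, 5, [2]⟩,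
  ⟨.north, 2, [3]⟩,
  ⟨.west, 4, [4]⟩,
  ⟨.south, 1, [5]⟩,
  ⟨.east, 1, [5]⟩,
  ⟨.north, 57, [17, 21, 24]⟩,
  ⟨.north, 59, [8, 11]⟩,
  ⟨.east, 2, [9]⟩,
  ⟨.south, 1, [10]⟩,
  ⟨.west, 1, [14]⟩,
  ⟨.west, 2, [12]⟩,
  ⟨.south, 1, [13]⟩,
  ⟨.east, 1, [14]⟩,
  ⟨.south, 58, [15, 16]⟩,
  ⟨.east, 1, [6]⟩,
  ⟨.west, 1, [6]⟩,
  ⟨.north, 4604, [18]⟩,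
  ⟨.west, 1, [19]⟩,
  ⟨.north, 1, [20]⟩,
  ⟨.east, 1, [7]⟩,
  ⟨.east, 11, [22]⟩,
  ⟨.north, 1, [23]⟩,
  ⟨.west, 1, [7]⟩,
  ⟨.west, 2, [25]⟩,
  ⟨.south, 1, [26]⟩,
  ⟨.west, 2, [27]⟩,
  ⟨.north, 1, [28]⟩,
  ⟨.east, 1, [7]⟩]

def strand (j : Fin 29) : Strand := strandList[j]'(j.2.trans_eq (by decide))

/-- The strand that follows strand `j` in direction `d`. -/
def branch (j : Fin 29) (d : Dir) : Option (Fin 29) :=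
  (strand j).next.find? fun i => (strand i).dir = d

theorem strand_len_pos : ∀ j, 0 < (strand j).len := by decide +kernel

theorem branch_opp : ∀ j, branch j (strand j).dir.opp = none := by decide +kernel

theorem zero_notMem_next : ∀ j, (0 : Fin 29) ∉ (strand j).next := by decide +kernel

theorem mem_next_of_branch {j i : Fin 29} {d : Dir} (h : branch j d = some i) :
    i ∈ (strand j).next :=
  List.mem_of_find?_eq_some h

theorem dir_of_branch {j i : Fin 29} {d : Dir} (h : branch j d = some i) : (strand i).dir = d := by
  simpa using List.find?_some h

/-- The tile kinds: the places on the strands. -/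
abbrev StrandKind : Type := Σ j : Fin 29, Fin (strand j).len

/-- The first kind of a strand. -/
def strandHead (j : Fin 29) : StrandKind := ⟨j, 0, strand_len_pos j⟩

/-- The successor of a kind in a given direction. -/
def strandOut (t : StrandKind) (d : Dir) : Option StrandKind :=
  if h : t.2.1 + 1 < (strand t.1).len then
    if d = (strand t.1).dir then some ⟨t.1, t.2.1 + 1, h⟩ else none
  else (branch t.1 d).map strandHead

theorem strandOut_cases {t u : StrandKind} {d : Dir} (h : strandOut t d = some u) :
    (∃ hk : t.2.1 + 1 < (strand t.1).len, d = (strand t.1).dir ∧ u = ⟨t.1, t.2.1 + 1, hk⟩) ∨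
      (t.2.1 + 1 = (strand t.1).len ∧ ∃ i, branch t.1 d = some i ∧ u = strandHead i) := by
  unfold strandOut at h
  split_ifs at h with h1 h2
  · exact Or.inl ⟨h1, h2, (Option.some.inj h).symm⟩
  · obtain ⟨i, hi, hu⟩ := Option.map_eq_some_iff.1 h
    exact Or.inr ⟨by have := t.2.2; omega, i, hi, hu.symm⟩

theorem strandOut_of_lt {t : StrandKind} (h : t.2.1 + 1 < (strand t.1).len) :
    strandOut t (strand t.1).dir = some ⟨t.1, t.2.1 + 1, h⟩ := by
  rw [strandOut, dif_pos h, if_pos rfl]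

theorem strandOut_of_eq {t : StrandKind} (h : t.2.1 + 1 = (strand t.1).len) (d : Dir) :
    strandOut t d = (branch t.1 d).map strandHead := by
  rw [strandOut, dif_neg h.not_lt]

/-- The system of the tile kinds of the strands. -/
def strandSystem : KindSystem StrandKind where
  label t := t.1 + 29 * t.2
  label_injective := by
    rintro ⟨j, k⟩ ⟨j', k'⟩ h
    have h : j.1 + 29 * k.1 = j'.1 + 29 * k'.1 := h
    obtain rfl : j = j' := Fin.ext (by omega)
    obtain rfl : k = k' := Fin.ext (by omega)
    rfl
  dir t := (strand t.1).dir
  seedKind := strandHead 0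
  out := strandOut
  dir_of_out {t d u} h := by
    rcases strandOut_cases h with ⟨-, rfl, rfl⟩ | ⟨-, i, hi, rfl⟩
    · rfl
    · exact dir_of_branch hi
  out_opp {t} _ := by
    unfold strandOut
    split_ifs with h1 h2
    · exact absurd h2 (Dir.opp_ne _)
    · rfl
    · rw [branch_opp]
      rfl
  out_ne_seed {t d u} h := by
    rcases strandOut_cases h with ⟨hk, -, rfl⟩ | ⟨-, i, hi, rfl⟩
    · intro he
      have := congrArg (fun s : StrandKind => s.2.1) he
      exact absurd this (Nat.succ_ne_zero _)
    · intro he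
      obtain rfl : i = 0 := congrArg Sigma.fst he
      exact zero_notMem_next _ (mem_next_of_branch hi)

theorem card_strandKind : Fintype.card StrandKind = 4825 := by
  rw [Fintype.card_sigma]
  simp only [Fintype.card_fin]
  decide +kernel

/-! ### The arms of the terminal assembly and the finite checks on them -/

/-- A straight part of the assembly: an initial segment of a strand, the position of its first tile
and the index of the arm after whose last tile it grows. -/
structure Arm where
  strand : Fin 29
  len : ℕ
  x : ℤ
  y : ℤ
  parent : Fin 94

/-- The arms of the assembly. -/
def armList : List Arm := [
  ⟨0, 1, 0, 0, 0⟩, ⟨6, 57, 0, 1, 0⟩, ⟨1, 5, 1, 0, 0⟩, ⟨17, 4604, 0, 58, 1⟩, ⟨21, 11, 1, 57, 1⟩,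
  ⟨24, 2, -1, 57, 1⟩, ⟨2, 2, 5, 1, 2⟩, ⟨18, 1, -1, 4661, 3⟩, ⟨22, 1, 11, 58, 4⟩,
  ⟨25, 1, -2, 56, 5⟩, ⟨3, 4, 4, 2, 6⟩, ⟨19, 1, -1, 4662, 7⟩, ⟨23, 1, 10, 58, 8⟩,
  ⟨26, 2, -3, 56, 9⟩, ⟨4, 1, 1, 1, 10⟩, ⟨20, 1, 0, 4662, 11⟩, ⟨7, 59, 10, 59, 12⟩,
  ⟨27, 1, -4, 57, 13⟩, ⟨5, 1, 2, 1, 14⟩, ⟨7, 59, 0, 4663, 15⟩, ⟨8, 2, 11, 117, 16⟩,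
  ⟨11, 2, 9, 117, 16⟩, ⟨28, 1, -3, 57, 17⟩, ⟨5, 1, 3, 1, 18⟩, ⟨8, 2, 1, 4721, 19⟩,
  ⟨11, 2, -1, 4721, 19⟩, ⟨9, 1, 12, 116, 20⟩, ⟨12, 1, 8, 116, 21⟩, ⟨7, 59, -3, 58, 22⟩,
  ⟨5, 1, 4, 1, 23⟩, ⟨9, 1, 2, 4720, 24⟩, ⟨12, 1, -2, 4720, 25⟩, ⟨10, 1, 11, 116, 26⟩,
  ⟨13, 1, 9, 116, 27⟩, ⟨8, 2, -2, 116, 28⟩, ⟨11, 2, -4, 116, 28⟩, ⟨10, 1, 1, 4720, 30⟩,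
  ⟨13, 1, -1, 4720, 31⟩, ⟨14, 57, 11, 115, 32⟩, ⟨14, 58, 9, 115, 33⟩, ⟨9, 1, -1, 115, 34⟩,
  ⟨12, 1, -5, 115, 35⟩, ⟨14, 58, 1, 4719, 36⟩, ⟨14, 57, -1, 4719, 37⟩, ⟨16, 1, 8, 58, 39⟩,
  ⟨10, 1, -2, 115, 40⟩, ⟨13, 1, -4, 115, 41⟩, ⟨15, 1, 2, 4662, 42⟩, ⟨6, 57, 8, 59, 44⟩,
  ⟨14, 57, -2, 114, 45⟩, ⟨14, 57, -4, 114, 46⟩, ⟨6, 57, 2, 4663, 47⟩, ⟨24, 2, 7, 115, 48⟩,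
  ⟨21, 11, 3, 4719, 51⟩, ⟨25, 1, 6, 114, 52⟩, ⟨22, 1, 13, 4720, 53⟩, ⟨26, 2, 5, 114, 54⟩,
  ⟨23, 1, 12, 4720, 55⟩, ⟨27, 1, 4, 115, 56⟩, ⟨7, 59, 12, 4721, 57⟩, ⟨28, 1, 5, 115, 58⟩,
  ⟨8, 2, 13, 4779, 59⟩, ⟨11, 2, 11, 4779, 59⟩, ⟨7, 59, 5, 116, 60⟩, ⟨9, 1, 14, 4778, 61⟩,
  ⟨12, 1, 10, 4778, 62⟩, ⟨8, 2, 6, 174, 63⟩, ⟨11, 2, 4, 174, 63⟩, ⟨10, 1, 13, 4778, 64⟩,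
  ⟨13, 1, 11, 4778, 65⟩, ⟨9, 1, 7, 173, 66⟩, ⟨12, 1, 3, 173, 67⟩, ⟨14, 57, 13, 4777, 68⟩,
  ⟨14, 58, 11, 4777, 69⟩, ⟨10, 1, 6, 173, 70⟩, ⟨13, 1, 4, 173, 71⟩, ⟨16, 1, 10, 4720, 73⟩,
  ⟨14, 57, 6, 172, 74⟩, ⟨14, 57, 4, 172, 75⟩, ⟨6, 57, 10, 4721, 76⟩, ⟨24, 2, 9, 4777, 79⟩,
  ⟨25, 1, 8, 4776, 80⟩, ⟨26, 2, 7, 4776, 81⟩, ⟨27, 1, 6, 4777, 82⟩, ⟨28, 1, 7, 4777, 83⟩,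
  ⟨7, 59, 7, 4778, 84⟩, ⟨8, 2, 8, 4836, 85⟩, ⟨11, 2, 6, 4836, 85⟩, ⟨9, 1, 9, 4835, 86⟩,
  ⟨12, 1, 5, 4835, 87⟩, ⟨10, 1, 8, 4835, 88⟩, ⟨13, 1, 6, 4835, 89⟩, ⟨14, 57, 8, 4834, 90⟩,
  ⟨14, 57, 6, 4834, 91⟩]

def arm (r : Fin 94) : Arm := armList[r]'(r.2.trans_eq (by decide))

namespace Arm

/-- The unit vector along an arm. -/
def vec (a : Arm) : ℤ × ℤ := (_root_.strand a.strand).dir.vec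

/-- The position of the `k`-th tile of an arm. -/
def point (a : Arm) (k : ℤ) : ℤ × ℤ := (a.x + k * a.vec.1, a.y + k * a.vec.2)

/-- Whether a position is on an arm. -/
def contains (a : Arm) (p : ℤ × ℤ) : Bool :=
  let k := (p.1 - a.x) * a.vec.1 + (p.2 - a.y) * a.vec.2
  0 ≤ k && k < a.len && a.point k = p

theorem exists_of_contains {a : Arm} {p : ℤ × ℤ} (h : a.contains p = true) :
    ∃ k : ℕ, k < a.len ∧ a.point k = p := by
  simp only [contains, Bool.and_eq_true, decide_eq_true_eq] at h
  obtain ⟨⟨h0, h1⟩, h2⟩ := h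
  lift (p.1 - a.x) * a.vec.1 + (p.2 - a.y) * a.vec.2 to ℕ using h0 with k
  exact ⟨k, by exact_mod_cast h1, h2⟩

/-- Two arms are separated by a horizontal or a vertical line. -/
def Separated (a b : Arm) : Prop :=
  let p := a.point (a.len - 1)
  let q := b.point (b.len - 1)
  max a.x p.1 < min b.x q.1 ∨ max b.x q.1 < min a.x p.1 ∨
    max a.y p.2 < min b.y q.2 ∨ max b.y q.2 < min a.y p.2

instance (a b : Arm) : Decidable (Separated a b) := by
  unfold Separated
  infer_instance

theorem point_mem_box (a : Arm) {k : ℕ} (hk : k < a.len) :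
    (min a.x (a.point (a.len - 1)).1 ≤ (a.point k).1 ∧ (a.point k).1 ≤ max a.x (a.point (a.len - 1)).1) ∧
      min a.y (a.point (a.len - 1)).2 ≤ (a.point k).2 ∧ (a.point k).2 ≤ max a.y (a.point (a.len - 1)).2 := by
  unfold Arm.point vec
  cases (_root_.strand a.strand).dir <;> simp only [Dir.vec] <;> omega

theorem Separated.point_ne {a b : Arm} (h : a.Separated b) {k l : ℕ} (hk : k < a.len)
    (hl : l < b.len) : a.point k ≠ b.point l := by
  intro he
  obtain ⟨⟨h1, h2⟩, h3, h4⟩ := a.point_mem_box hk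
  obtain ⟨⟨g1, g2⟩, g3, g4⟩ := b.point_mem_box hl
  rw [he] at h1 h2 h3 h4
  unfold Separated at h
  simp only at h
  omega

/-- A position in the region that the assembly occupies. -/
def InRegion (p : ℤ × ℤ) : Prop :=
  0 ≤ p.1 + p.2 ∧ p.1 + p.2 ≤ 4845 ∧ -4840 ≤ p.1 - p.2 ∧ p.1 - p.2 ≤ 5

instance (p : ℤ × ℤ) : Decidable (InRegion p) := by
  unfold InRegion
  infer_instance

/-- The region is convex, so it suffices to test the two ends of an arm. -/
theorem InRegion.point {a : Arm} (h : InRegion (a.x, a.y)) (h' : InRegion (a.point (a.len - 1)))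
    {k : ℕ} (hk : k < a.len) : InRegion (a.point k) := by
  unfold InRegion Arm.point vec at *
  revert h h'
  cases (_root_.strand a.strand).dir <;> simp only [Dir.vec] <;> omega

/-- Manhattan distance is the larger of the differences in `x + y` and in `x - y`; both range over
intervals of length 4845. -/
theorem InRegion.manhattanDist_le {p q : ℤ × ℤ} (hp : InRegion p) (hq : InRegion q) :
    manhattanDist p q ≤ 4845 := by
  unfold InRegion at hp hq
  unfold manhattanDist
  omega

end Arm

/-- Whether a position is on an arm or on one of the at most `n - 1` arms before it. -/
def blocked : ℕ → Fin 94 → ℤ × ℤ → Bool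
  | 0, _, _ => false
  | n + 1, r, p => (arm r).contains p || (r != 0 && blocked n (arm r).parent p)

theorem arm_len : ∀ r, 0 < (arm r).len ∧ (arm r).len ≤ (strand (arm r).strand).len := by
  decide +kernel

theorem arm_parent : ∀ r, r ≠ 0 → (arm r).parent < r ∧
    (arm (arm r).parent).len = (strand (arm (arm r).parent).strand).len ∧
    branch (arm (arm r).parent).strand (strand (arm r).strand).dir = some (arm r).strand ∧
    ((arm r).x, (arm r).y) =
      (arm (arm r).parent).point ((arm (arm r).parent).len - 1) + (arm r).vec := by
  decide +kernel

/-- An arm that stops early must run into its own ancestry; a collision with another branch would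
make the outcome depend on timing. The fuel 94 suffices because parent indices decrease. -/
theorem arm_truncated : ∀ r, (arm r).len < (strand (arm r).strand).len →
    blocked 94 r ((arm r).point ((arm r).len - 1) + (arm r).vec) = true := by
  decide +kernel

theorem arm_complete : ∀ r, (arm r).len = (strand (arm r).strand).len →
    ∀ i ∈ (strand (arm r).strand).next,
      blocked 94 r ((arm r).point ((arm r).len - 1) + (strand i).dir.vec) = true ∨
        ∃ s, s ≠ 0 ∧ (arm s).parent = r ∧ (arm s).strand = i := by
  decide +kernel

theorem armList_pairwise : armList.Pairwise Arm.Separated := by decide +kernel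

theorem arm_separated {r s : Fin 94} (h : r ≠ s) :
    (arm r).Separated (arm s) ∨ (arm s).Separated (arm r) := by
  have hp := List.pairwise_iff_getElem.1 armList_pairwise
  rcases lt_or_gt_of_ne h with h | h
  · exact Or.inl (hp _ _ _ _ h)
  · exact Or.inr (hp _ _ _ _ h)

theorem arm_inRegion : ∀ r, Arm.InRegion ((arm r).x, (arm r).y) ∧
    Arm.InRegion ((arm r).point ((arm r).len - 1)) := by
  decide +kernel

/-! ### From arms to the tree of nodes -/

/-- The nodes of the assembly: the places on the arms. -/
abbrev Node : Type := Σ r : Fin 94, Fin (arm r).len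

namespace Node

/-- The position of a node. -/
def pos (v : Node) : ℤ × ℤ := (arm v.1).point (v.2 : ℕ)

/-- The tile kind at a node. -/
def kind (v : Node) : StrandKind := ⟨(arm v.1).strand, v.2, v.2.2.trans_le (arm_len v.1).2⟩

/-- The first node of an arm. -/
def first (r : Fin 94) : Node := ⟨r, 0, (arm_len r).1⟩

/-- The last node of an arm. -/
def last (r : Fin 94) : Node := ⟨r, (arm r).len - 1, Nat.sub_lt (arm_len r).1 Nat.one_pos⟩

/-- The node from which a node grows. -/
def parent : Node → Node
  | ⟨r, 0, _⟩ => last (arm r).parent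
  | ⟨r, k + 1, h⟩ => ⟨r, k, Nat.lt_of_succ_lt h⟩

theorem parent_first (r : Fin 94) : parent (first r) = last (arm r).parent := rfl

theorem pos_injective : Function.Injective pos := by
  rintro ⟨r, k, hk⟩ ⟨s, l, hl⟩ h
  by_cases hrs : r = s
  · subst hrs
    have : k = l := by
      unfold pos Arm.point Arm.vec at h
      revert h
      cases (strand (arm r).strand).dir <;> simp [Dir.vec]
    subst this
    rfl
  · rcases arm_separated hrs with hs | hs
    · exact absurd h (hs.point_ne hk hl)
    · exact absurd h.symm (hs.point_ne hl hk)

theorem pos_last (r : Fin 94) : pos (last r) = (arm r).point ((arm r).len - 1) := by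
  unfold pos last
  rw [Nat.cast_sub (arm_len r).1, Nat.cast_one]

theorem pos_first (r : Fin 94) : pos (first r) = ((arm r).x, (arm r).y) := by
  simp [pos, first, Arm.point]

theorem pos_succ (r : Fin 94) (k : ℕ) (h : k + 1 < (arm r).len) :
    pos ⟨r, k + 1, h⟩ = pos ⟨r, k, Nat.lt_of_succ_lt h⟩ + (arm r).vec := by
  ext <;> simp [pos, Arm.point] <;> ring

theorem iterate_parent (r : Fin 94) (k l : ℕ) (h : k + l < (arm r).len) :
    parent^[l] ⟨r, k + l, h⟩ = ⟨r, k, by omega⟩ := by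
  induction l with
  | zero => rfl
  | succ l ih => exact ih (by omega)

theorem exists_iterate_last (r : Fin 94) (k : ℕ) (h : k < (arm r).len) :
    ∃ l, parent^[l] (last r) = ⟨r, k, h⟩ := by
  refine ⟨(arm r).len - 1 - k, ?_⟩
  have := iterate_parent r k ((arm r).len - 1 - k) (by omega)
  rw [← this]
  congr 1
  simp only [last, Sigma.mk.injEq, heq_eq_eq, Fin.mk.injEq, true_and]
  omega

/-- A child arm starts after the last tile of its parent arm, so every tile of every arm in the
chain is an ancestor. -/
theorem exists_iterate_of_blocked {n : ℕ} {r : Fin 94} {p : ℤ × ℤ} (h : blocked n r p = true) :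
    ∃ l, pos (parent^[l] (last r)) = p := by
  induction n generalizing r with
  | zero => cases h
  | succ n ih =>
    rw [blocked, Bool.or_eq_true] at h
    rcases h with h | h
    · obtain ⟨k, hk, hp⟩ := Arm.exists_of_contains h
      obtain ⟨l, hl⟩ := exists_iterate_last r k hk
      exact ⟨l, by rw [hl]; exact hp⟩
    · obtain ⟨l, hl⟩ := ih (Bool.and_eq_true_iff.1 h).2
      obtain ⟨m, hm⟩ := exists_iterate_last r 0 (arm_len r).1
      refine ⟨l + (m + 1), ?_⟩
      rw [Function.iterate_add_apply, Function.iterate_succ_apply', hm]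
      exact hl

theorem len_zero : (arm 0).len = 1 := by decide +kernel

theorem eq_root {k : ℕ} (h : k < (arm 0).len) : (⟨0, k, h⟩ : Node) = first 0 := by
  have := len_zero
  obtain rfl : k = 0 := by omega
  rfl

theorem parent_root : parent (first 0) = first 0 := by
  have h : (arm 0).parent = 0 := by decide +kernel
  rw [parent_first, h]
  exact eq_root _

theorem exists_iterate_root (v : Node) : ∃ k, parent^[k] v = first 0 := by
  obtain ⟨r, k, hk⟩ := v
  -- Induction on the arm index works because parent arms come earlier in the list.
  induction r using WellFoundedLT.induction generalizing k with
  | ind r ih =>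
    have hl := iterate_parent r 0 k (by omega)
    simp only [zero_add] at hl
    by_cases hr : r = 0
    · subst hr
      exact ⟨k, hl⟩
    · obtain ⟨n, hn⟩ := ih _ (arm_parent r hr).1 _ (last (arm r).parent).2.2
      refine ⟨n + 1 + k, ?_⟩
      rw [Function.iterate_add_apply, hl, Function.iterate_succ_apply]
      exact hn

theorem out_parent {v : Node} (hv : v ≠ first 0) :
    strandOut (kind (parent v)) (strand (kind v).1).dir = some (kind v) := by
  obtain ⟨r, _ | k, hk⟩ := v
  · have hr : r ≠ 0 := by
      rintro rfl
      exact hv rfl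
    obtain ⟨-, h1, h2, -⟩ := arm_parent r hr
    have hlast : (kind (last (arm r).parent)).2.1 + 1 =
        (strand (kind (last (arm r).parent)).1).len := by
      change (arm (arm r).parent).len - 1 + 1 = (strand (arm (arm r).parent).strand).len
      have := (arm_len (arm r).parent).1
      omega
    exact (strandOut_of_eq hlast _).trans (congrArg (Option.map strandHead) h2)
  · exact strandOut_of_lt (t := kind ⟨r, k, Nat.lt_of_succ_lt hk⟩) (hk.trans_le (arm_len r).2)

theorem pos_eq {v : Node} (hv : v ≠ first 0) :
    pos v = pos (parent v) + (strand (kind v).1).dir.vec := by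
  obtain ⟨r, _ | k, hk⟩ := v
  · have hr : r ≠ 0 := by
      rintro rfl
      exact hv rfl
    have h := (arm_parent r hr).2.2.2
    change pos (first r) = pos (last (arm r).parent) + _
    rw [pos_first, pos_last, h]
    rfl
  · exact pos_succ r k hk

theorem complete {v : Node} {d : Dir} {u : StrandKind} (h : strandOut (kind v) d = some u) :
    (∃ w, w ≠ first 0 ∧ parent w = v ∧ kind w = u) ∨
      ∃ k, pos (parent^[k] v) = pos v + d.vec := by
  obtain ⟨r, k, hk⟩ := v
  have hle := arm_len r
  have hlast : k + 1 = (arm r).len → (⟨r, k, hk⟩ : Node) = last r := by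
    intro he
    simp only [last, Sigma.mk.injEq, heq_eq_eq, Fin.mk.injEq, true_and]
    omega
  rcases strandOut_cases h with ⟨hk', rfl, rfl⟩ | ⟨hk', i, hi, rfl⟩
  · by_cases hkr : k + 1 < (arm r).len
    · refine Or.inl ⟨⟨r, k + 1, hkr⟩, fun he => ?_, rfl, rfl⟩
      have := congrArg (fun w : Node => w.2.1) he
      exact absurd this (Nat.succ_ne_zero _)
    · have hk' : k + 1 < (strand (arm r).strand).len := hk'
      right
      rw [hlast (by omega), pos_last]
      exact exists_iterate_of_blocked (arm_truncated r (by omega))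
  · have hk' : k + 1 = (strand (arm r).strand).len := hk'
    rw [hlast (by omega)]
    rcases arm_complete r (by omega) i (mem_next_of_branch hi) with hb | ⟨s, hs, hsr, rfl⟩
    · right
      rw [pos_last, ← dir_of_branch hi]
      exact exists_iterate_of_blocked hb
    · refine Or.inl ⟨first s, fun he => hs (congrArg Sigma.fst he), ?_, rfl⟩
      rw [parent_first, hsr]

theorem inRegion (v : Node) : Arm.InRegion v.pos :=
  Arm.InRegion.point (arm_inRegion v.1).1 (arm_inRegion v.1).2 v.2.2

end Node

/-- The terminal assembly as a tree of tiles. -/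
def armTree : GrowthTree strandSystem Node where
  pos := Node.pos
  pos_injective := Node.pos_injective
  kind := Node.kind
  root := Node.first 0
  parent := Node.parent
  kind_root := by
    have h : (arm 0).strand = 0 := by decide +kernel
    unfold Node.kind Node.first
    change (⟨(arm 0).strand, 0, _⟩ : StrandKind) = strandHead 0
    unfold strandHead
    congr 1
  parent_root := Node.parent_root
  out_parent := Node.out_parent
  pos_eq := Node.pos_eq
  exists_iterate := Node.exists_iterate_root
  complete := Node.complete

/-! ### The two ends of the pumped path, and the theorem -/

/-- The last tile of the branch that ends with three equal tiles. -/
def Node.pumpEnd : Node := Node.first 29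

/-- A tile at the greatest distance from the seed. -/
def Node.summit : Node := Node.last 86

theorem Node.parent_ne_pumpEnd (v : Node) : v.parent ≠ Node.pumpEnd := by
  have hl : (arm 29).len = 1 := by decide +kernel
  have hp : ∀ s, (arm s).parent ≠ 29 := by decide +kernel
  obtain ⟨s, _ | k, hk⟩ := v
  · exact fun he => hp s (congrArg Sigma.fst he)
  · intro he
    obtain rfl : s = 29 := congrArg Sigma.fst he
    omega

theorem Node.eq_pumpEnd {v : Node} (h : v.parent = Node.pumpEnd.parent) : v = Node.pumpEnd := by
  have hl : (arm 23).len = 1 := by decide +kernel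
  have hp : ∀ s, (arm s).parent = 23 → s = 29 := by decide +kernel
  have hp' : (arm 29).parent = 23 := by decide +kernel
  obtain ⟨s, _ | k, hk⟩ := v
  · obtain rfl := hp s ((congrArg Sigma.fst h).trans hp')
    rfl
  · obtain rfl : s = 23 := (congrArg Sigma.fst h).trans hp'
    omega

theorem manhattanDiam_eq {S : Set (ℤ × ℤ)} {n : ℕ} (hle : ∀ p ∈ S, ∀ q ∈ S, manhattanDist p q ≤ n)
    {p q : ℤ × ℤ} (hp : p ∈ S) (hq : q ∈ S) (h : manhattanDist p q = n) : manhattanDiam S = n := by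
  apply le_antisymm
  · exact iSup₂_le fun p hp => iSup₂_le fun q hq => by exact_mod_cast hle p hp q hq
  · rw [← h]
    exact le_iSup₂_of_le p hp (le_iSup₂_of_le (f := fun q _ => (manhattanDist p q : ℕ∞)) q hq le_rfl)

theorem manhattanRadius_eq {S : Set (ℤ × ℤ)} {o : ℤ × ℤ} {n : ℕ}
    (hle : ∀ p ∈ S, manhattanDist o p ≤ n) {p : ℤ × ℤ} (hp : p ∈ S) (h : manhattanDist o p = n) :
    manhattanRadius o S = n := by
  apply le_antisymm
  · exact iSup₂_le fun p hp => by exact_mod_cast hle p hp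
  · rw [← h]
    exact le_iSup₂_of_le (f := fun q _ => (manhattanDist o q : ℕ∞)) p hp le_rfl

theorem lt_manhattanDiam {S : Set (ℤ × ℤ)} {n : ℕ} {p q : ℤ × ℤ} (hp : p ∈ S) (hq : q ∈ S)
    (h : n < manhattanDist p q) : (n : ℕ∞) < manhattanDiam S :=
  lt_of_lt_of_le (Nat.cast_lt.2 h)
    (le_iSup₂_of_le p hp (le_iSup₂_of_le (f := fun q _ => (manhattanDist p q : ℕ∞)) q hq le_rfl))

theorem mainTheorem2 :
    ∃ (𝒯 : TileAssemblySystem) (o : ℤ × ℤ),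
      𝒯.temperature = 1 ∧ 𝒯.seed.dom = {o} ∧ 𝒯.tiles.card = 4825 ∧
      (¬ ∃ a : ℕ → Assembly 𝒯.tiles,
        a 0 = 𝒯.seed ∧ ∀ i, Assembly.Step 𝒯.temperature (a i) (a (i + 1))) ∧
      ∀ α ∈ 𝒯.terminalAssemblies,
        manhattanRadius o α.dom = 4845 ∧ manhattanDiam α.dom = 4845 ∧
        ∃ (u v : α.dom) (P : α.bindingGraph.Walk u v),
          P.IsPath ∧
          ((𝒯.tiles.card + 1 : ℕ) : ℕ∞) < manhattanDiam (Assembly.positions P) ∧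
          Assembly.PartiallyPumped P := by
  have hcard : armTree.system.tiles.card = 4825 :=
    strandSystem.tiles_card.trans card_strandKind
  refine ⟨armTree.system, armTree.pos armTree.root, rfl, armTree.dom_seed, hcard,
    GrowthTree.not_exists_infinite, fun α hα => ?_⟩
  have hall := GrowthTree.pos_mem_of_terminal hα
  have hdom : ∀ p ∈ α.dom, Arm.InRegion p := by
    intro p hp
    obtain ⟨v, rfl⟩ := (GrowthTree.dom_of_terminal hα).subset hp
    exact v.inRegion
  -- The summit is at `(9, 4836)` and the seed at the origin.
  have hdist : manhattanDist (armTree.pos armTree.root) (armTree.pos Node.summit) = 4845 := by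
    decide +kernel
  refine ⟨?_, ?_, ?_⟩
  · exact manhattanRadius_eq (n := 4845)
      (fun p hp => (hdom _ (hall armTree.root)).manhattanDist_le (hdom p hp)) (hall _) hdist
  · exact manhattanDiam_eq (n := 4845)
      (fun p hp q hq => (hdom p hp).manhattanDist_le (hdom q hq)) (hall _) (hall _) hdist
  · obtain ⟨P, hP, hpump⟩ := GrowthTree.exists_pumped_path
      (GrowthTree.covers_of_mem_productions hα.1) hall (a := Node.pumpEnd) (b := Node.summit)
      Node.parent_ne_pumpEnd (fun v => Node.eq_pumpEnd) (by decide +kernel) (by decide +kernel)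
      (by decide +kernel) (by decide +kernel) (by decide +kernel)
    refine ⟨_, _, P, hP, ?_, hpump⟩
    rw [hcard]
    refine lt_manhattanDiam (p := armTree.pos Node.pumpEnd) (q := armTree.pos Node.summit)
      ⟨_, P.start_mem_support, rfl⟩ ⟨_, P.end_mem_support, rfl⟩ ?_
    -- From the tip `(4, 1)` to the summit the distance is 4840, above the required 4826.
    decide +kernel
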